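/- Write $P_V$ for the law of a random variable $V$. For a random variable $V$ with values in $\mathbb{R}$ or $\mathbb{C}\cong\mathbb{R}^2$ whose law has a density $f$ with respect to one- or two-dimensional Lebesgue measure, let $h(V)=-\int f\log f$ (natural logarithm) be its differential entropy; $h(V)$ is said to exist and be finite if $V$ has a density $f$ and $f\log f$ is Lebesgue integrable. (a) Let $X,Y$ be i.i.d. random variables taking values in $(0,\infty)$ almost surely, such that $h(X)$, $h(XY)$ and $h(X/Y)$ exist and are finite and $\log X$ is integrable. Then $$h(XY)\le 2h(X/Y)-h(X)+3\,\mathbf{E}[\log X],\qquad h(X/Y)\le 2h(XY)-h(X)-3\,\mathbf{E}[\log X].$$ (b) Let $T=\{z\in\mathbb{C}:|z|=1\}$, with multiplication as group operation, let $U$ be uniformly distributed on $T$, and write $D(\Theta\|U)=D(P_\Theta\|P_U)\in[0,\infty]$ for the relative entropy. Let $\Theta,\Theta'$ be i.i.d. random variables with values in $T$ such that $D(\Theta\|U)<\infty$. Then $D(\Theta\Theta'\|U)$ and $D(\Theta/\Theta'\|U)$ are finite, and $$\tfrac12\big(D(\Theta\|U)-D(\Theta/\Theta'\|U)\big)\le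 D(\Theta\|U)-D(\Theta\Theta'\|U)\le 2\big(D(\Theta\|U)-D(\Theta/\Theta'\|U)\big);$$ in particular, whenever $D(\Theta/\Theta'\|U)\ne D(\Theta\|U)$, $$\frac12\le\frac{D(\Theta\|U)-D(\Theta\Theta'\|U)}{D(\Theta\|U)-D(\Theta/\Theta'\|U)}\le 2.$$ (c) Let $Z_1,Z_2$ be i.i.d. complex random variables, almost surely nonzero, such that $h(Z_1)$, $h(Z_1Z_2)$ and $h(Z_1/Z_2)$ exist and are finite and $\log|Z_1|$ is integrable. Then $$h(Z_1Z_2)\le 2h(Z_1/Z_2)-h(Z_1)+6\,\mathbf{E}[\log|Z_1|],\qquad h(Z_1/Z_2)\le 2h(Z_1Z_2)-h(Z_1)-6\,\mathbf{E}[\log|Z_1|].$$ -/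

import Mathlib

open MeasureTheory ProbabilityTheory

noncomputable section

/-- The density of the law of `X` with respect to the reference (Lebesgue) measure of `E`. -/
def density {Ω E : Type*} [MeasurableSpace Ω] [MeasureSpace E] (X : Ω → E) (μ : Measure Ω) :
    E → ℝ :=
  fun x => ((μ.map X).rnDeriv volume x).toReal

/-- The differential entropy `-∫ f log f` (in nats), `f` the density of `X`. It is meaningful
only under `HasFiniteEntropy X μ`. -/
def diffEntropy {Ω E : Type*} [MeasurableSpace Ω] [MeasureSpace E] (X : Ω → E) (μ : Measure Ω) :
    ℝ :=
  -∫ x, density X μ x * Real.log (density X μ x)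

/-- `X` has a density `f`, and the integral of `f log f` exists and is finite. -/
structure HasFiniteEntropy {Ω E : Type*} [MeasurableSpace Ω] [MeasureSpace E]
    (X : Ω → E) (μ : Measure Ω) : Prop where
  aemeasurable : AEMeasurable X μ
  absolutelyContinuous : μ.map X ≪ volume
  integrable : Integrable (fun x => density X μ x * Real.log (density X μ x)) volume

/-- The Borel sigma-algebra of the unit circle. -/
instance instMeasurableSpaceUnitCircle : MeasurableSpace Circle := borel Circle

instance instBorelSpaceUnitCircle : BorelSpace Circle := ⟨rfl⟩

/-- The uniform distribution on the unit circle: the Haar measure of total mass one. -/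
def circleUniform : Measure Circle := Measure.haarMeasure ⊤

/-- The relative entropy `D(Θ ‖ U)` of a circle-valued random variable with respect to the
uniform distribution, with values in `[0, ∞]`. -/
def relEntropyUniform {Ω : Type*} [MeasurableSpace Ω] (Θ : Ω → Circle) (μ : Measure Ω) :
    ENNReal :=
  InformationTheory.klDiv (μ.map Θ) circleUniform

end

/-! All three parts are one statement about an abelian group with an invariant reference measure.
Write `h` for minus the integral of the log-likelihood ratio, and let X, Y be independent with law
`ν`, and Z independent of them with law `κ`. Two inequalities suffice: the Ruzsa triangle inequality
h(X/Y) + h(Z) ≤ 2h(XZ), used with `κ = ν`, and h(XY) + h(Z) ≤ 2h(XZ), used with `κ = ν.inv`. They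
are `two_mul_integral_llr_mconv_le_div` and `two_mul_integral_llr_mconv_le_mul`.

Both come from log r ≤ r - 1, where r is a ratio of densities at (x, y, z) whose integral against
the joint law is at most 1. No conditional entropies are needed, and only the logarithms of the
densities in the conclusion must be integrable.

On the circle, minus `h` is the relative entropy, and its finiteness passes to products and
quotients by data processing. For ℝ and ℂ the group is `Kˣ` with measure dz/|z|^d, d = 1 or 2;
changing the reference measure from Lebesgue measure adds d·E log|V| to the negative entropy, which
produces the constants 3 and 6. -/

open scoped ENNReal

/-! ### Entropy inequalities on an abelian group -/

section Group

variable {G : Type*} [MeasurableSpace G]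

/-- Integrating against a measure with the inverse of its density costs at most the reference
measure. -/
lemma lintegral_mul_inv_rnDeriv_le {ρ lam : Measure G} [ρ.HaveLebesgueDecomposition lam]
    (h : ρ ≪ lam) {A : G → ℝ≥0∞} (hA : Measurable A) :
    ∫⁻ x, A x * (ρ.rnDeriv lam x)⁻¹ ∂ρ ≤ ∫⁻ x, A x ∂lam := by
  rw [← lintegral_rnDeriv_mul h (by fun_prop)]
  refine lintegral_mono fun x => ?_
  rw [mul_left_comm]
  exact mul_le_of_le_one_right' (ENNReal.mul_inv_le_one _)

lemma ae_rnDeriv_ne_zero_and_ne_top {ρ lam : Measure G} [SigmaFinite ρ] [SigmaFinite lam]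
    (h : ρ ≪ lam) : ∀ᵐ x ∂ρ, ρ.rnDeriv lam x ≠ 0 ∧ ρ.rnDeriv lam x ≠ ∞ := by
  filter_upwards [Measure.rnDeriv_pos h, h.ae_le (Measure.rnDeriv_lt_top ρ lam)] with x h1 h2
  exact ⟨h1.ne', h2.ne⟩

/-- The integrated form of log r ≤ r - 1. The constant `c` counts how many such inequalities are
added pointwise. -/
lemma integral_le_zero_of_le_toReal_sub {P : Measure G} [IsProbabilityMeasure P] {F : G → ℝ}
    (hF : Integrable F P) {R : G → ℝ≥0∞} (hR : AEMeasurable R P) {c : ℝ} (hc : 0 ≤ c)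
    (hRc : ∫⁻ x, R x ∂P ≤ ENNReal.ofReal c) (hle : ∀ᵐ x ∂P, F x ≤ (R x).toReal - c) :
    ∫ x, F x ∂P ≤ 0 := by
  have hne : ∫⁻ x, R x ∂P ≠ ∞ := (hRc.trans_lt ENNReal.ofReal_lt_top).ne
  have hi : Integrable (fun x => (R x).toReal) P := integrable_toReal_of_lintegral_ne_top hR hne
  calc ∫ x, F x ∂P ≤ ∫ x, ((R x).toReal - c) ∂P :=
        integral_mono_ae hF (hi.sub (integrable_const c)) hle
    _ = (∫⁻ x, R x ∂P).toReal - c := by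
        rw [integral_sub hi (integrable_const c), integral_toReal hR (ae_lt_top' hR hne)]
        simp
    _ ≤ 0 := by
        rw [sub_nonpos]
        exact ENNReal.toReal_le_of_le_ofReal hc hRc

lemma log_div_le_toReal_sub_one {a b c d : ℝ≥0∞} (ha : a ≠ 0 ∧ a ≠ ∞) (hb : b ≠ 0 ∧ b ≠ ∞)
    (hc : c ≠ 0 ∧ c ≠ ∞) (hd : d ≠ 0 ∧ d ≠ ∞) :
    Real.log a.toReal + Real.log b.toReal - Real.log c.toReal - Real.log d.toReal
      ≤ (a * b * c⁻¹ * d⁻¹).toReal - 1 := by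
  have ha' := ENNReal.toReal_pos ha.1 ha.2
  have hb' := ENNReal.toReal_pos hb.1 hb.2
  have hc' := ENNReal.toReal_pos hc.1 hc.2
  have hd' := ENNReal.toReal_pos hd.1 hd.2
  have h := Real.log_le_sub_one_of_pos
    (show 0 < a.toReal * b.toReal * c.toReal⁻¹ * d.toReal⁻¹ by positivity)
  rw [Real.log_mul (by positivity) (by positivity), Real.log_mul (by positivity) (by positivity),
    Real.log_mul (by positivity) (by positivity), Real.log_inv, Real.log_inv] at h
  simp only [ENNReal.toReal_mul, ENNReal.toReal_inv]
  linarith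

lemma measurePreserving_comp_fst_snd_fst (ν κ : Measure G) [IsProbabilityMeasure ν]
    [IsProbabilityMeasure κ] {θ : G × G → G} (hθ : Measurable θ) :
    MeasurePreserving (fun q : G × G × G => θ (q.1, q.2.1)) (ν.prod (ν.prod κ))
      ((ν.prod ν).map θ) :=
  MeasurePreserving.comp (⟨hθ, rfl⟩ : MeasurePreserving θ (ν.prod ν) ((ν.prod ν).map θ))
    ((MeasurePreserving.id ν).prod measurePreserving_fst)

lemma integral_llr_comp_of_measurePreserving {α : Type*} [MeasurableSpace α] {P : Measure α}
    {ρ lam : Measure G} {f : α → G} (hf : MeasurePreserving f P ρ) :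
    ∫ a, (llr ρ lam ∘ f) a ∂P = ∫ x, llr ρ lam x ∂ρ := by
  conv_rhs => rw [← hf.map_eq]
  rw [integral_map hf.aemeasurable
    (by rw [hf.map_eq]; exact (measurable_llr _ _).aestronglyMeasurable), hf.map_eq]
  rfl

variable [CommGroup G] [MeasurableMul₂ G]
  {lam ν κ : Measure G}
  [IsProbabilityMeasure ν] [IsProbabilityMeasure κ]

variable (ν κ) in
lemma measurePreserving_fst_mul_snd_snd :
    MeasurePreserving (fun q : G × G × G => q.1 * q.2.2) (ν.prod (ν.prod κ)) (ν ∗ₘ κ) :=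
  MeasurePreserving.comp (⟨measurable_mul, rfl⟩ :
    MeasurePreserving (fun q : G × G => q.1 * q.2) (ν.prod κ) (ν ∗ₘ κ))
    ((MeasurePreserving.id ν).prod measurePreserving_snd)

variable (ν κ) in
lemma measurePreserving_snd_fst_mul_snd_snd :
    MeasurePreserving (fun q : G × G × G => q.2.1 * q.2.2) (ν.prod (ν.prod κ)) (ν ∗ₘ κ) :=
  MeasurePreserving.comp (⟨measurable_mul, rfl⟩ :
    MeasurePreserving (fun q : G × G => q.1 * q.2) (ν.prod κ) (ν ∗ₘ κ)) measurePreserving_snd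

/-- The common frame of both entropy inequalities: `θ` is division or multiplication, and each of
the four logarithms integrates to its own entropy because its argument has the matching law. -/
lemma two_mul_integral_llr_mconv_le_of_forall {θ : G × G → G} (hθ : Measurable θ)
    (hσi : Integrable (llr (ν ∗ₘ κ) lam) (ν ∗ₘ κ))
    (hτi : Integrable (llr ((ν.prod ν).map θ) lam) ((ν.prod ν).map θ))
    (hκi : Integrable (llr κ lam) κ) {R : G × G × G → ℝ≥0∞} (hR : Measurable R) {c : ℝ}
    (hc : 0 ≤ c) (hRc : ∫⁻ q, R q ∂(ν.prod (ν.prod κ)) ≤ ENNReal.ofReal c)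
    (hle : ∀ᵐ q ∂(ν.prod (ν.prod κ)),
      llr (ν ∗ₘ κ) lam (q.1 * q.2.2) + llr (ν ∗ₘ κ) lam (q.2.1 * q.2.2)
        - llr ((ν.prod ν).map θ) lam (θ (q.1, q.2.1)) - llr κ lam q.2.2 ≤ (R q).toReal - c) :
    2 * ∫ x, llr (ν ∗ₘ κ) lam x ∂(ν ∗ₘ κ)
      ≤ ∫ x, llr ((ν.prod ν).map θ) lam x ∂((ν.prod ν).map θ) + ∫ x, llr κ lam x ∂κ := by
  have h1 := measurePreserving_fst_mul_snd_snd ν κ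
  have h2 := measurePreserving_snd_fst_mul_snd_snd ν κ
  have h3 := measurePreserving_comp_fst_snd_fst ν κ hθ
  have h4 : MeasurePreserving (fun q : G × G × G => q.2.2) (ν.prod (ν.prod κ)) κ :=
    measurePreserving_snd.comp measurePreserving_snd
  have i1 := h1.integrable_comp_of_integrable hσi
  have i2 := h2.integrable_comp_of_integrable hσi
  have i3 := h3.integrable_comp_of_integrable hτi
  have i4 := h4.integrable_comp_of_integrable hκi
  have key := integral_le_zero_of_le_toReal_sub (((i1.add i2).sub i3).sub i4) hR.aemeasurable
    hc hRc hle
  rw [integral_sub' ((i1.add i2).sub i3) i4, integral_sub' (i1.add i2) i3, integral_add' i1 i2,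
    integral_llr_comp_of_measurePreserving h1, integral_llr_comp_of_measurePreserving h2,
    integral_llr_comp_of_measurePreserving h3,
    integral_llr_comp_of_measurePreserving h4] at key
  linarith

variable [SigmaFinite lam]

lemma ae_forall_rnDeriv_ne_zero_and_ne_top {θ : G × G → G} (hθ : Measurable θ)
    (hσ : ν ∗ₘ κ ≪ lam) (hτ : (ν.prod ν).map θ ≪ lam) (hκ : κ ≪ lam) :
    ∀ᵐ q ∂(ν.prod (ν.prod κ)),
      ((ν ∗ₘ κ).rnDeriv lam (q.1 * q.2.2) ≠ 0 ∧ (ν ∗ₘ κ).rnDeriv lam (q.1 * q.2.2) ≠ ∞) ∧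
      ((ν ∗ₘ κ).rnDeriv lam (q.2.1 * q.2.2) ≠ 0 ∧ (ν ∗ₘ κ).rnDeriv lam (q.2.1 * q.2.2) ≠ ∞) ∧
      (((ν.prod ν).map θ).rnDeriv lam (θ (q.1, q.2.1)) ≠ 0 ∧
        ((ν.prod ν).map θ).rnDeriv lam (θ (q.1, q.2.1)) ≠ ∞) ∧
      (κ.rnDeriv lam q.2.2 ≠ 0 ∧ κ.rnDeriv lam q.2.2 ≠ ∞) := by
  filter_upwards [(measurePreserving_fst_mul_snd_snd ν κ).quasiMeasurePreserving.ae
      (ae_rnDeriv_ne_zero_and_ne_top hσ),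
    (measurePreserving_snd_fst_mul_snd_snd ν κ).quasiMeasurePreserving.ae
      (ae_rnDeriv_ne_zero_and_ne_top hσ),
    (measurePreserving_comp_fst_snd_fst ν κ hθ).quasiMeasurePreserving.ae
      (ae_rnDeriv_ne_zero_and_ne_top hτ),
    ((measurePreserving_snd (μ := ν) (ν := κ)).comp
      (measurePreserving_snd (μ := ν))).quasiMeasurePreserving.ae
      (ae_rnDeriv_ne_zero_and_ne_top hκ)] with q h1 h2 h3 h4
  exact ⟨h1, h2, h3, h4⟩

variable [MeasurableInv G] [lam.IsMulLeftInvariant]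

/-- An entropic Ruzsa triangle inequality. -/
lemma two_mul_integral_llr_mconv_le_div (hκ : κ ≪ lam) (hσ : ν ∗ₘ κ ≪ lam)
    (hτ : (ν.prod ν).map (fun q => q.1 / q.2) ≪ lam)
    (hσi : Integrable (llr (ν ∗ₘ κ) lam) (ν ∗ₘ κ))
    (hτi : Integrable (llr ((ν.prod ν).map (fun q => q.1 / q.2)) lam)
      ((ν.prod ν).map (fun q => q.1 / q.2)))
    (hκi : Integrable (llr κ lam) κ) :
    2 * ∫ x, llr (ν ∗ₘ κ) lam x ∂(ν ∗ₘ κ)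
      ≤ ∫ x, llr ((ν.prod ν).map (fun q => q.1 / q.2)) lam x ∂((ν.prod ν).map (fun q => q.1 / q.2))
        + ∫ x, llr κ lam x ∂κ := by
  have hθ : Measurable (fun q : G × G => q.1 / q.2) := by fun_prop
  have hae := ae_forall_rnDeriv_ne_zero_and_ne_top hθ hσ hτ hκ
  set p := (ν ∗ₘ κ).rnDeriv lam with hp
  set τ := (ν.prod ν).map (fun q : G × G => q.1 / q.2) with hτd
  have hpm : Measurable p := Measure.measurable_rnDeriv _ _
  have hp1 : ∫⁻ x, p x ∂lam = 1 := by
    rw [hp, Measure.lintegral_rnDeriv hσ, measure_univ]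
  have : IsProbabilityMeasure τ := Measure.isProbabilityMeasure_map hθ.aemeasurable
  refine two_mul_integral_llr_mconv_le_of_forall hθ hσi hτi hκi
    (R := fun q => p (q.1 * q.2.2) * p (q.2.1 * q.2.2) * (τ.rnDeriv lam (q.1 / q.2.1))⁻¹ *
      (κ.rnDeriv lam q.2.2)⁻¹) (by fun_prop) zero_le_one ?_ ?_
  -- By invariance, the integral of p(xz)p(yz) over z depends only on x/y. So the density of X/Y can
  -- be cancelled next, and `K` has total mass 1.
  · set K : G → ℝ≥0∞ := fun w => ∫⁻ z, p (w * z) * p z ∂lam with hK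
    have hKm : Measurable K := Measurable.lintegral_prod_right' (f := fun q : G × G =>
      p (q.1 * q.2) * p q.2) (by fun_prop)
    have hinner : ∀ x y, ∫⁻ z, p (x * z) * p (y * z) * (τ.rnDeriv lam (x / y))⁻¹ *
        (κ.rnDeriv lam z)⁻¹ ∂κ ≤ K (x / y) * (τ.rnDeriv lam (x / y))⁻¹ := by
      intro x y
      refine (lintegral_mul_inv_rnDeriv_le hκ
        (A := fun z => p (x * z) * p (y * z) * (τ.rnDeriv lam (x / y))⁻¹) (by fun_prop)).trans ?_
      rw [lintegral_mul_const _ (by fun_prop), hK]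
      gcongr
      change _ ≤ ∫⁻ z, p (x / y * z) * p z ∂lam
      rw [← lintegral_mul_left_eq_self (fun z => p (x / y * z) * p z) y]
      simp [← mul_assoc]
    calc _ ≤ ∫⁻ x, ∫⁻ y, K (x / y) * (τ.rnDeriv lam (x / y))⁻¹ ∂ν ∂ν := by
          rw [lintegral_prod _ (by fun_prop)]
          refine lintegral_mono fun x => ?_
          rw [lintegral_prod _ (by fun_prop)]
          exact lintegral_mono fun y => hinner x y
      _ = ∫⁻ w, K w * (τ.rnDeriv lam w)⁻¹ ∂τ := by
          rw [hτd, lintegral_map (by fun_prop) hθ, lintegral_prod _ (by fun_prop)]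
      _ ≤ ∫⁻ w, K w ∂lam := lintegral_mul_inv_rnDeriv_le hτ hKm
      _ = ∫⁻ z, ∫⁻ w, p (w * z) * p z ∂lam ∂lam := lintegral_lintegral_swap (by fun_prop)
      _ = 1 := by
          have hz : ∀ z, ∫⁻ w, p (w * z) * p z ∂lam = p z := fun z => by
            rw [lintegral_mul_const _ (by fun_prop), lintegral_mul_right_eq_self, hp1, one_mul]
          simp_rw [hz, hp1]
      _ = _ := by simp
  · filter_upwards [hae] with q ⟨a, b, c, d⟩
    exact log_div_le_toReal_sub_one a b c d

/-- The entropy of a product of independent random variables is submodular. -/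
lemma two_mul_integral_llr_mconv_le_mul (hκ : κ ≪ lam) (hσ : ν ∗ₘ κ ≪ lam)
    (hτ : ν ∗ₘ ν ≪ lam)
    (hσi : Integrable (llr (ν ∗ₘ κ) lam) (ν ∗ₘ κ))
    (hτi : Integrable (llr (ν ∗ₘ ν) lam) (ν ∗ₘ ν))
    (hκi : Integrable (llr κ lam) κ) :
    2 * ∫ x, llr (ν ∗ₘ κ) lam x ∂(ν ∗ₘ κ)
      ≤ ∫ x, llr (ν ∗ₘ ν) lam x ∂(ν ∗ₘ ν) + ∫ x, llr κ lam x ∂κ := by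
  have hae := ae_forall_rnDeriv_ne_zero_and_ne_top measurable_mul hσ hτ hκ
  change ∀ᵐ q : G × G × G ∂_, _ ∧ _ ∧ ((ν ∗ₘ ν).rnDeriv lam (q.1 * q.2.1) ≠ 0 ∧
    (ν ∗ₘ ν).rnDeriv lam (q.1 * q.2.1) ≠ ∞) ∧ _ at hae
  set p := (ν ∗ₘ κ).rnDeriv lam with hp
  set s := (ν ∗ₘ ν).rnDeriv lam with hs
  have hpm : Measurable p := Measure.measurable_rnDeriv _ _
  have hsm : Measurable s := Measure.measurable_rnDeriv _ _
  have hp1 : ∫⁻ x, p x ∂lam = 1 := by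
    rw [hp, Measure.lintegral_rnDeriv hσ, measure_univ]
  -- `t` is a density of XYZ. The claim combines submodularity, h(XYZ) + h(Z) ≤ h(XZ) + h(YZ), with
  -- h(XY) ≤ h(XYZ); these correspond to `R₁` and `R₂`. Adding them pointwise cancels log t, so its
  -- integrability is never needed.
  set t : G → ℝ≥0∞ := fun v => ∫⁻ x, p (v / x) ∂ν with ht
  have htm : Measurable t := Measurable.lintegral_prod_right' (f := fun q : G × G =>
    p (q.1 / q.2)) (by fun_prop)
  have ht1 : ∫⁻ v, t v ∂lam = 1 := by
    rw [ht, lintegral_lintegral_swap (by fun_prop)]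
    simp_rw [div_eq_mul_inv, lintegral_mul_right_eq_self, hp1]
    simp
  set R₁ : G × G × G → ℝ≥0∞ := fun q => p (q.1 * q.2.2) * p (q.2.1 * q.2.2) *
    (t (q.1 * q.2.1 * q.2.2))⁻¹ * (κ.rnDeriv lam q.2.2)⁻¹ with hR₁
  set R₂ : G × G × G → ℝ≥0∞ := fun q => t (q.1 * q.2.1 * q.2.2) * (s (q.1 * q.2.1))⁻¹ with hR₂
  have hR₁m : Measurable R₁ := by fun_prop
  have hR₂m : Measurable R₂ := by fun_prop
  have h₁ : ∫⁻ q, R₁ q ∂(ν.prod (ν.prod κ)) ≤ 1 := by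
    have hinner : ∀ x y, ∫⁻ z, p (x * z) * p (y * z) * (t (x * y * z))⁻¹ *
        (κ.rnDeriv lam z)⁻¹ ∂κ ≤ ∫⁻ v, p (v / y) * p (v / x) * (t v)⁻¹ ∂lam := by
      intro x y
      refine (lintegral_mul_inv_rnDeriv_le hκ
        (A := fun z => p (x * z) * p (y * z) * (t (x * y * z))⁻¹) (by fun_prop)).trans ?_
      -- The substitution v = xyz separates the variables: integrating over y and then over x gives
      -- one factor t(v) each.
      rw [← lintegral_mul_left_eq_self (fun v => p (v / y) * p (v / x) * (t v)⁻¹) (x * y)]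
      refine le_of_eq (lintegral_congr fun z => ?_)
      congr 4
      · rw [mul_right_comm, mul_div_cancel_right]
      · rw [mul_assoc, mul_div_cancel_left]
    calc _ ≤ ∫⁻ x, ∫⁻ y, ∫⁻ v, p (v / y) * p (v / x) * (t v)⁻¹ ∂lam ∂ν ∂ν := by
          rw [lintegral_prod _ (by fun_prop)]
          refine lintegral_mono fun x => ?_
          rw [lintegral_prod _ (by fun_prop)]
          exact lintegral_mono fun y => hinner x y
      _ = ∫⁻ x, ∫⁻ v, t v * p (v / x) * (t v)⁻¹ ∂lam ∂ν := by
          refine lintegral_congr fun x => ?_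
          rw [lintegral_lintegral_swap (by fun_prop)]
          refine lintegral_congr fun v => ?_
          rw [lintegral_mul_const _ (by fun_prop), lintegral_mul_const _ (by fun_prop)]
      _ = ∫⁻ v, t v * t v * (t v)⁻¹ ∂lam := by
          rw [lintegral_lintegral_swap (by fun_prop)]
          refine lintegral_congr fun v => ?_
          rw [lintegral_mul_const _ (by fun_prop), lintegral_const_mul _ (by fun_prop)]
      _ ≤ ∫⁻ v, t v ∂lam := by
          refine lintegral_mono fun v => ?_
          rw [mul_assoc]
          exact mul_le_of_le_one_right' (ENNReal.mul_inv_le_one _)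
      _ = 1 := ht1
  have h₂ : ∫⁻ q, R₂ q ∂(ν.prod (ν.prod κ)) ≤ 1 := by
    have hm : Measurable (fun w => ∫⁻ z, t (w * z) ∂κ) :=
      Measurable.lintegral_prod_right' (f := fun q : G × G => t (q.1 * q.2)) (by fun_prop)
    calc _ = ∫⁻ x, ∫⁻ y, (∫⁻ z, t (x * y * z) ∂κ) * (s (x * y))⁻¹ ∂ν ∂ν := by
          rw [lintegral_prod _ (by fun_prop)]
          refine lintegral_congr fun x => ?_
          rw [lintegral_prod _ (by fun_prop)]
          refine lintegral_congr fun y => ?_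
          simp only [hR₂]
          rw [lintegral_mul_const _ (by fun_prop)]
      _ = ∫⁻ w, (∫⁻ z, t (w * z) ∂κ) * (s w)⁻¹ ∂(ν ∗ₘ ν) := by
          rw [Measure.lintegral_mconv (f := fun w => (∫⁻ z, t (w * z) ∂κ) * (s w)⁻¹)
            (by fun_prop)]
      _ ≤ ∫⁻ w, ∫⁻ z, t (w * z) ∂κ ∂lam := lintegral_mul_inv_rnDeriv_le hτ hm
      _ = ∫⁻ z, ∫⁻ w, t (w * z) ∂lam ∂κ := lintegral_lintegral_swap (by fun_prop)
      _ = 1 := by simp [lintegral_mul_right_eq_self, ht1]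
  refine two_mul_integral_llr_mconv_le_of_forall measurable_mul hσi hτi hκi
    (R := fun q => R₁ q + R₂ q) (by fun_prop) zero_le_two ?_ ?_
  · rw [lintegral_add_left hR₁m]
    exact (add_le_add h₁ h₂).trans (by norm_num [one_add_one_eq_two])
  · filter_upwards [hae, ae_lt_top hR₁m (h₁.trans_lt ENNReal.one_lt_top).ne,
      ae_lt_top hR₂m (h₂.trans_lt ENNReal.one_lt_top).ne] with q ⟨a, b, c, d⟩ f₁ f₂
    -- Degenerate values of `t` are excluded by finiteness of the ratios: t = 0 would make `R₁`
    -- infinite, and t = ∞ would make `R₂` infinite.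
    have ht0 : t (q.1 * q.2.1 * q.2.2) ≠ 0 := by
      intro h0
      simp only [hR₁, h0] at f₁
      simp [a, b, d] at f₁
    have htt : t (q.1 * q.2.1 * q.2.2) ≠ ∞ := by
      intro h0
      simp only [hR₂, h0] at f₂
      simp [c] at f₂
    have e₁ := log_div_le_toReal_sub_one a b ⟨ht0, htt⟩ d
    have e₂ := log_div_le_toReal_sub_one ⟨ht0, htt⟩ (b := 1) (by simp) c (d := 1) (by simp)
    simp only [mul_one, inv_one, ENNReal.toReal_one, Real.log_one] at e₂
    rw [ENNReal.toReal_add f₁.ne f₂.ne]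
    change Real.log _ + Real.log _ - Real.log (s _).toReal - Real.log _ ≤ _
    linarith

end Group

/-! ### Log-likelihood ratios under measurable embeddings -/

section Embedding

variable {α β : Type*} [MeasurableSpace α] [MeasurableSpace β] {e : α → β}
  {ρ lam : Measure α} [SigmaFinite ρ] [SigmaFinite lam]

lemma MeasurableEmbedding.llr_map_comp_ae_eq (he : MeasurableEmbedding e) (h : ρ ≪ lam) :
    llr (ρ.map e) (lam.map e) ∘ e =ᵐ[ρ] llr ρ lam := by
  filter_upwards [h.ae_le (he.rnDeriv_map ρ lam)] with x hx
  simp [llr, hx]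

lemma MeasurableEmbedding.integrable_llr_map_iff (he : MeasurableEmbedding e) (h : ρ ≪ lam) :
    Integrable (llr (ρ.map e) (lam.map e)) (ρ.map e) ↔ Integrable (llr ρ lam) ρ := by
  rw [he.integrable_map_iff, integrable_congr (he.llr_map_comp_ae_eq h)]

lemma MeasurableEmbedding.integral_llr_map (he : MeasurableEmbedding e) (h : ρ ≪ lam) :
    ∫ y, llr (ρ.map e) (lam.map e) y ∂(ρ.map e) = ∫ x, llr ρ lam x ∂ρ := by
  rw [he.integral_map]
  exact integral_congr_ae (he.llr_map_comp_ae_eq h)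

end Embedding

/-! ### Products and quotients of i.i.d. group-valued variables -/

section GroupInequalities

lemma integrable_and_integral_llr_inv {G : Type*} [MeasurableSpace G] [CommGroup G] [MeasurableInv G]
    {lam : Measure G} [SigmaFinite lam] [lam.IsInvInvariant] {ν : Measure G} [SigmaFinite ν] (h : ν ≪ lam)
    (hi : Integrable (llr ν lam) ν) :
    ν.inv ≪ lam ∧ Integrable (llr ν.inv lam) ν.inv ∧
      ∫ x, llr ν.inv lam x ∂ν.inv = ∫ x, llr ν lam x ∂ν := by
  have he : MeasurableEmbedding (Inv.inv : G → G) := (MeasurableEquiv.inv G).measurableEmbedding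
  have hl : lam.map Inv.inv = lam := Measure.inv_eq_self lam
  have h1 := he.integrable_llr_map_iff h
  have h2 := he.integral_llr_map h
  have h3 := h.map (measurable_inv (G := G))
  rw [hl] at h1 h2 h3
  exact ⟨h3, h1.2 hi, h2⟩

/-- Convolution with a probability measure does not increase the divergence from an invariant
probability measure. -/
lemma klDiv_mconv_le {G : Type*} [MeasurableSpace G] [CommGroup G] [MeasurableMul₂ G]
    {lam : Measure G} [IsProbabilityMeasure lam] [lam.IsMulLeftInvariant]
    (ν κ : Measure G) [IsProbabilityMeasure ν] [IsProbabilityMeasure κ] :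
    InformationTheory.klDiv (ν ∗ₘ κ) lam ≤ InformationTheory.klDiv ν lam := by
  have hlam : lam ∗ₘ κ = lam := by
    refine Measure.ext_of_lintegral _ fun f hf => ?_
    rw [Measure.lintegral_mconv hf, lintegral_lintegral_swap (by fun_prop)]
    simp [lintegral_mul_right_eq_self]
  calc InformationTheory.klDiv (ν ∗ₘ κ) lam
      = InformationTheory.klDiv (ν ∗ₘ κ) (lam ∗ₘ κ) := by rw [hlam]
    -- Data processing along multiplication; the shared factor `κ` then contributes no divergence.
    _ ≤ InformationTheory.klDiv (ν.prod κ) (lam.prod κ) :=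
        InformationTheory.klDiv_map_le _ _ measurable_mul
    _ = InformationTheory.klDiv ν lam := by
        rw [← Measure.compProd_const, ← Measure.compProd_const,
          InformationTheory.klDiv_compProd_left]

variable {Ω G : Type*} [MeasurableSpace Ω] [MeasurableSpace G] [CommGroup G] [MeasurableMul₂ G]
  [MeasurableInv G]

lemma prod_map_div_eq_mconv_inv (ν : Measure G) [SFinite ν] :
    (ν.prod ν).map (fun q => q.1 / q.2) = ν ∗ₘ ν.inv := by
  rw [Measure.mconv, Measure.inv]
  conv_rhs =>
    enter [2, 1]
    rw [← Measure.map_id (μ := ν)]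
  rw [Measure.map_prod_map _ _ measurable_id measurable_inv,
    Measure.map_map measurable_mul (by fun_prop)]
  congr 1
  ext q
  simp [div_eq_mul_inv]

variable {lam : Measure G} [SigmaFinite lam] [lam.IsMulLeftInvariant] [lam.IsInvInvariant]

/-- The negative entropies (relative to an invariant measure) of the product and the quotient of
two i.i.d. random variables are close to each other. -/
theorem two_mul_integral_llr_mul_le_and_div_le {μ : Measure Ω} [IsProbabilityMeasure μ]
    {X Y : Ω → G} (hind : IndepFun X Y μ) (hid : IdentDistrib X Y μ μ)
    (hX : μ.map X ≪ lam) (hXi : Integrable (llr (μ.map X) lam) (μ.map X))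
    (hm : μ.map (X * Y) ≪ lam) (hmi : Integrable (llr (μ.map (X * Y)) lam) (μ.map (X * Y)))
    (hd : μ.map (X / Y) ≪ lam) (hdi : Integrable (llr (μ.map (X / Y)) lam) (μ.map (X / Y))) :
    2 * ∫ x, llr (μ.map (X * Y)) lam x ∂(μ.map (X * Y))
        ≤ ∫ x, llr (μ.map (X / Y)) lam x ∂(μ.map (X / Y)) + ∫ x, llr (μ.map X) lam x ∂(μ.map X) ∧
      2 * ∫ x, llr (μ.map (X / Y)) lam x ∂(μ.map (X / Y))
        ≤ ∫ x, llr (μ.map (X * Y)) lam x ∂(μ.map (X * Y)) + ∫ x, llr (μ.map X) lam x ∂(μ.map X) := by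
  have hXm := hid.aemeasurable_fst
  have hYm := hid.aemeasurable_snd
  have : IsProbabilityMeasure (μ.map X) := Measure.isProbabilityMeasure_map hXm
  have hmul : μ.map (X * Y) = μ.map X ∗ₘ μ.map X := by
    rw [hind.map_mul_eq_map_mconv_map₀ hXm hYm, hid.map_eq]
  have hdiv : μ.map (X / Y) = ((μ.map X).prod (μ.map X)).map (fun q => q.1 / q.2) := by
    nth_rw 2 [hid.map_eq]
    rw [← (indepFun_iff_map_prod_eq_prod_map_map hXm hYm).1 hind,
      AEMeasurable.map_map_of_aemeasurable (by fun_prop) (hXm.prodMk hYm)]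
    rfl
  have hdiv' := hdiv.trans (prod_map_div_eq_mconv_inv _)
  obtain ⟨i1, i2, i3⟩ := integrable_and_integral_llr_inv hX hXi
  have : IsProbabilityMeasure (μ.map X).inv :=
    Measure.isProbabilityMeasure_map measurable_inv.aemeasurable
  constructor
  · rw [hmul] at hm hmi ⊢
    rw [hdiv] at hd hdi ⊢
    exact two_mul_integral_llr_mconv_le_div hX hm hd hmi hdi hXi
  · rw [← i3]
    rw [hmul] at hm hmi ⊢
    rw [hdiv'] at hd hdi ⊢
    -- Here `κ` is the law of 1/X, so `ν ∗ₘ κ` is the law of the quotient.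
    exact two_mul_integral_llr_mconv_le_mul i1 hd hm hdi hmi i2

/-- A left-invariant measure is inversion invariant if some symmetric set has positive finite
measure. -/
lemma isInvInvariant_of_symmetric {lam : Measure G} [SigmaFinite lam] [lam.IsMulLeftInvariant]
    {S : Set G} (hinv : S⁻¹ = S) (h0 : lam S ≠ 0) (htop : lam S ≠ ∞) :
    lam.IsInvInvariant := by
  refine ⟨Measure.ext fun t _ => ?_⟩
  -- Left-invariant measures are proportional; equal masses on the symmetric set `S` force the
  -- factor to be 1.
  have h := measure_mul_measure_eq lam.inv lam S t h0 htop
  rw [Measure.inv_apply _ S, hinv] at h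
  exact ((ENNReal.mul_right_inj h0 htop).1 h).symm

end GroupInequalities

/-! ### Relative entropy on the circle -/

section UnitCircle

instance : IsProbabilityMeasure circleUniform := by
  refine ⟨?_⟩
  simpa [circleUniform] using
    Measure.haarMeasure_self (K₀ := (⊤ : TopologicalSpace.PositiveCompacts Circle))

instance : circleUniform.IsHaarMeasure := by
  unfold circleUniform
  infer_instance

lemma two_mul_relEntropyUniform_mul_le_and_div_le {Ω : Type*} [MeasurableSpace Ω] {μ : Measure Ω} [IsProbabilityMeasure μ]
    {Θ Θ' : Ω → Circle} (hind : IndepFun Θ Θ' μ) (hid : IdentDistrib Θ Θ' μ μ)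
    (hfin : relEntropyUniform Θ μ ≠ ⊤) :
    relEntropyUniform (Θ * Θ') μ ≠ ⊤ ∧ relEntropyUniform (Θ / Θ') μ ≠ ⊤ ∧
    2 * (relEntropyUniform (Θ * Θ') μ).toReal
      ≤ (relEntropyUniform (Θ / Θ') μ).toReal + (relEntropyUniform Θ μ).toReal ∧
    2 * (relEntropyUniform (Θ / Θ') μ).toReal
      ≤ (relEntropyUniform (Θ * Θ') μ).toReal + (relEntropyUniform Θ μ).toReal := by
  have hm := hid.aemeasurable_fst
  have hm' := hid.aemeasurable_snd
  have p1 : IsProbabilityMeasure (μ.map Θ) := Measure.isProbabilityMeasure_map hm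
  have p2 : IsProbabilityMeasure (μ.map Θ') := Measure.isProbabilityMeasure_map hm'
  have p3 : IsProbabilityMeasure (μ.map Θ'⁻¹) := Measure.isProbabilityMeasure_map hm'.inv
  have p4 : IsProbabilityMeasure (μ.map (Θ * Θ')) := Measure.isProbabilityMeasure_map (hm.mul hm')
  have p5 : IsProbabilityMeasure (μ.map (Θ / Θ')) := Measure.isProbabilityMeasure_map (hm.div hm')
  have f1 : relEntropyUniform (Θ * Θ') μ ≠ ⊤ := by
    refine ne_top_of_le_ne_top hfin ?_
    unfold relEntropyUniform
    rw [hind.map_mul_eq_map_mconv_map₀ hm hm']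
    exact klDiv_mconv_le _ _
  have f2 : relEntropyUniform (Θ / Θ') μ ≠ ⊤ := by
    refine ne_top_of_le_ne_top hfin ?_
    unfold relEntropyUniform
    rw [div_eq_mul_inv, IndepFun.map_mul_eq_map_mconv_map₀ hm hm'.inv
      (hind.comp measurable_id measurable_inv)]
    exact klDiv_mconv_le _ _
  refine ⟨f1, f2, ?_⟩
  unfold relEntropyUniform at *
  rw [InformationTheory.klDiv_ne_top_iff] at hfin f1 f2
  -- The total masses agree, so the mass correction in `klDiv` vanishes and only the integral of
  -- `llr` remains.
  rw [InformationTheory.toReal_klDiv_of_measure_eq f1.1 (by simp),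
    InformationTheory.toReal_klDiv_of_measure_eq f2.1 (by simp),
    InformationTheory.toReal_klDiv_of_measure_eq hfin.1 (by simp)]
  exact two_mul_integral_llr_mul_le_and_div_le hind hid hfin.1 hfin.2 f1.1 f1.2 f2.1 f2.2

end UnitCircle

noncomputable section

/-! ### The multiplicative group of ℝ or ℂ and its invariant measure -/

section Units

lemma range_units_val {K : Type*} [Field K] : Set.range (Units.val : Kˣ → K) = {0}ᶜ := by
  ext x
  simp only [Set.mem_range, Set.mem_compl_iff, Set.mem_singleton_iff]
  exact ⟨fun ⟨u, hu⟩ => hu ▸ u.ne_zero, fun h => ⟨Units.mk0 x h, rfl⟩⟩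

lemma measurable_units_val {K : Type*} [Monoid K] [MeasurableSpace K] :
    Measurable (Units.val : Kˣ → K) := comap_measurable _

lemma measurable_units_iff {K α : Type*} [Monoid K] [MeasurableSpace K]
    [MeasurableSpace α] {f : α → Kˣ} :
    Measurable f ↔ Measurable fun x => (f x : K) :=
  measurable_comap_iff

open Classical in
/-- The unit with a given nonzero value; zero is sent to one. -/
def toUnit {K : Type*} [Field K] (x : K) : Kˣ := if h : x = 0 then 1 else Units.mk0 x h

lemma val_toUnit {K : Type*} [Field K] {x : K} (hx : x ≠ 0) : (toUnit x : K) = x := by simp [toUnit, hx]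

lemma ofReal_norm_pow_ne_zero {K : Type*} [RCLike K] {d : ℕ} {x : K} (hx : x ≠ 0) :
    ENNReal.ofReal (‖x‖ ^ d) ≠ 0 := by
  have := norm_pos_iff.2 hx
  simp only [ne_eq, ENNReal.ofReal_eq_zero, not_le]
  positivity

variable {K : Type*} [RCLike K] [MeasureSpace K] {d : ℕ}
variable [BorelSpace K]

lemma measurableEmbedding_units_val : MeasurableEmbedding (Units.val : Kˣ → K) := by
  refine ⟨Units.val_injective, measurable_units_val, ?_⟩
  rintro _ ⟨t, ht, rfl⟩
  rw [Set.image_preimage_eq_inter_range, range_units_val]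
  exact ht.inter (measurableSet_singleton 0).compl

instance : MeasurableMul₂ Kˣ :=
  ⟨measurable_units_iff.2 (by
    simp only [Units.val_mul]
    exact (measurable_units_val.comp measurable_fst).mul
      (measurable_units_val.comp measurable_snd))⟩

instance : MeasurableInv Kˣ :=
  ⟨measurable_units_iff.2 (by
    simp only [Units.val_inv_eq_inv_val]
    exact measurable_units_val.inv)⟩

lemma measurable_toUnit : Measurable (toUnit : K → Kˣ) := by
  refine measurable_units_iff.2 ?_
  have : (fun x : K => (toUnit x : K)) = fun x => if x ∈ ({0} : Set K) then 1 else x := by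
    ext x
    by_cases h : x = 0 <;> simp [toUnit, h]
  rw [this]
  exact Measurable.ite (measurableSet_singleton 0) measurable_const measurable_id

variable (K) in
/-- The measure `dz / |z| ^ d` on the field `K`. -/
def multiplicativeMeasure (d : ℕ) : Measure K :=
  volume.withDensity fun x => (ENNReal.ofReal (‖x‖ ^ d))⁻¹

variable (K) in
/-- The measure `dz / |z| ^ d` on the units of `K`. -/
def unitsMeasure (d : ℕ) : Measure Kˣ := (multiplicativeMeasure K d).comap Units.val

lemma volume_absolutelyContinuous_multiplicativeMeasure :
    (volume : Measure K) ≪ multiplicativeMeasure K d :=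
  withDensity_absolutelyContinuous' (by fun_prop) (by simp)

/-- The Jacobian of multiplication by `a` cancels against the change in the weight |x|^(-d). -/
lemma map_mul_left_multiplicativeMeasure
    (hscale : ∀ a : K, a ≠ 0 →
      (volume : Measure K).map (fun x => a * x) = (ENNReal.ofReal (‖a‖ ^ d))⁻¹ • volume)
    {a : K} (ha : a ≠ 0) :
    (multiplicativeMeasure K d).map (fun x => a * x) = multiplicativeMeasure K d := by
  refine Measure.ext_of_lintegral _ fun f hf => ?_
  have hw : Measurable fun x : K => (ENNReal.ofReal (‖x‖ ^ d))⁻¹ := by fun_prop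
  have h0 := ofReal_norm_pow_ne_zero (d := d) ha
  rw [lintegral_map hf (by fun_prop), multiplicativeMeasure,
    lintegral_withDensity_eq_lintegral_mul _ hw (by fun_prop),
    lintegral_withDensity_eq_lintegral_mul _ hw hf]
  have hpt : ∀ x : K, (ENNReal.ofReal (‖x‖ ^ d))⁻¹ * f (a * x) =
      ENNReal.ofReal (‖a‖ ^ d) * ((ENNReal.ofReal (‖a * x‖ ^ d))⁻¹ * f (a * x)) := by
    intro x
    rw [norm_mul, mul_pow, ENNReal.ofReal_mul (by positivity),
      ENNReal.mul_inv (Or.inl h0) (Or.inl ENNReal.ofReal_ne_top), ← mul_assoc, ← mul_assoc,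
      ENNReal.mul_inv_cancel h0 ENNReal.ofReal_ne_top, one_mul]
  simp only [Pi.mul_apply, hpt]
  rw [lintegral_const_mul _ (by fun_prop),
    ← lintegral_map (f := fun y => (ENNReal.ofReal (‖y‖ ^ d))⁻¹ * f y) (g := fun x => a * x)
      (by fun_prop) (by fun_prop), hscale a ha, lintegral_smul_measure, smul_eq_mul, ← mul_assoc,
    ENNReal.mul_inv_cancel h0 ENNReal.ofReal_ne_top, one_mul]

variable [(volume : Measure K).IsAddHaarMeasure]

lemma ae_ne_zero_volume : ∀ᵐ x : K, x ≠ 0 := by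
  simp [ae_iff]

instance : SigmaFinite (multiplicativeMeasure K d) := by
  refine SigmaFinite.withDensity_of_ne_top ?_
  filter_upwards [ae_ne_zero_volume (K := K)] with x hx
  simpa using ofReal_norm_pow_ne_zero hx

lemma map_unitsMeasure : (unitsMeasure K d).map Units.val = multiplicativeMeasure K d := by
  rw [unitsMeasure, measurableEmbedding_units_val.map_comap, range_units_val]
  refine Measure.restrict_eq_self_of_ae_mem ?_
  exact (withDensity_absolutelyContinuous _ _).ae_le ae_ne_zero_volume

instance : SigmaFinite (unitsMeasure K d) :=
  SigmaFinite.of_map _ measurable_units_val.aemeasurable (by rw [map_unitsMeasure]; infer_instance)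

lemma isMulLeftInvariant_unitsMeasure
    (hscale : ∀ a : K, a ≠ 0 →
      (volume : Measure K).map (fun x => a * x) = (ENNReal.ofReal (‖a‖ ^ d))⁻¹ • volume) :
    (unitsMeasure K d).IsMulLeftInvariant := by
  refine ⟨fun u => ?_⟩
  have he := measurableEmbedding_units_val (K := K)
  have h : ((unitsMeasure K d).map (fun x => u * x)).map Units.val
      = (unitsMeasure K d).map Units.val := by
    rw [Measure.map_map measurable_units_val (measurable_const_mul u)]
    have : (Units.val ∘ fun x => u * x : Kˣ → K) = (fun x => (u : K) * x) ∘ Units.val := by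
      ext x; simp
    rw [this, ← Measure.map_map (measurable_const_mul _) measurable_units_val, map_unitsMeasure,
      map_mul_left_multiplicativeMeasure hscale u.ne_zero]
  rw [← he.comap_map ((unitsMeasure K d).map _), h, he.comap_map]

lemma isInvInvariant_unitsMeasure
    (hscale : ∀ a : K, a ≠ 0 →
      (volume : Measure K).map (fun x => a * x) = (ENNReal.ofReal (‖a‖ ^ d))⁻¹ • volume) :
    (unitsMeasure K d).IsInvInvariant := by
  have := isMulLeftInvariant_unitsMeasure hscale
  -- An annulus stable under inversion and away from 0, where the weight is bounded; hence its
  -- measure is positive and finite.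
  set S : Set K := {x | 1 / 2 < ‖x‖ ∧ ‖x‖ < 2} with hS
  have hSo : IsOpen S := (isOpen_lt continuous_const continuous_norm).inter
    (isOpen_lt continuous_norm continuous_const)
  have hval : unitsMeasure K d (Units.val ⁻¹' S) = multiplicativeMeasure K d S := by
    rw [← map_unitsMeasure, Measure.map_apply measurable_units_val hSo.measurableSet]
  refine isInvInvariant_of_symmetric (S := Units.val ⁻¹' S) ?_ ?_ ?_
  · ext u
    have hu : 0 < ‖(u : K)‖ := norm_pos_iff.2 u.ne_zero
    simp only [hS, Set.mem_inv, Set.mem_preimage, Units.val_inv_eq_inv_val, Set.mem_ofPred_eq,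
      norm_inv]
    rw [inv_lt_comm₀ hu two_pos, one_div, inv_lt_inv₀ two_pos hu]
    exact and_comm
  · rw [hval]
    intro h0
    exact (hSo.measure_pos volume ⟨1, by norm_num [hS]⟩).ne'
      (volume_absolutelyContinuous_multiplicativeMeasure h0)
  · rw [hval, multiplicativeMeasure, withDensity_apply _ hSo.measurableSet]
    refine ne_of_lt ((setLIntegral_mono (g := fun _ => (ENNReal.ofReal ((1 / 2) ^ d))⁻¹)
      measurable_const fun x hx => ?_).trans_lt ?_)
    · gcongr
      exact hx.1.le
    · rw [setLIntegral_const]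
      refine ENNReal.mul_lt_top (by simp) ?_
      refine (measure_mono (t := Metric.closedBall 0 2) fun x hx => ?_).trans_lt
        measure_closedBall_lt_top
      simpa using hx.2.le

end Units

/-! ### Differential entropy in multiplicative terms -/

section Field

variable {K : Type*} [RCLike K] [MeasureSpace K] [BorelSpace K]
  [(volume : Measure K).IsAddHaarMeasure] {d : ℕ}
  {Ω : Type*} [MeasurableSpace Ω] {μ : Measure Ω} [IsProbabilityMeasure μ]

lemma llr_multiplicativeMeasure_ae_eq {ρ : Measure K} [SigmaFinite ρ] (h : ρ ≪ volume) :
    llr ρ (multiplicativeMeasure K d) =ᵐ[ρ]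
      fun x => d * Real.log ‖x‖ + Real.log (ρ.rnDeriv volume x).toReal := by
  have hd := h.ae_le (Measure.rnDeriv_withDensity_right ρ volume
    (f := fun x : K => (ENNReal.ofReal (‖x‖ ^ d))⁻¹) (by fun_prop) (by simp) (by
      filter_upwards [ae_ne_zero_volume (K := K)] with x hx
      simpa using ofReal_norm_pow_ne_zero hx))
  filter_upwards [hd, h.ae_le ae_ne_zero_volume, ae_rnDeriv_ne_zero_and_ne_top h] with x hx h0 hr
  have hn := norm_pos_iff.2 h0
  rw [llr, multiplicativeMeasure, hx, inv_inv, ENNReal.toReal_mul,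
    ENNReal.toReal_ofReal (by positivity),
    Real.log_mul (by positivity) (ENNReal.toReal_pos hr.1 hr.2).ne', Real.log_pow]

/-- The entropy of a nonzero random variable relative to the invariant measure of the
multiplicative group, in terms of its differential entropy. -/
lemma HasFiniteEntropy.llr_unitsMeasure {V : Ω → K} (hV : HasFiniteEntropy V μ) {W : Ω → Kˣ}
    (hW : AEMeasurable W μ) (hWV : ∀ᵐ ω ∂μ, (W ω : K) = V ω)
    (hlog : Integrable (fun ω => Real.log ‖V ω‖) μ) :
    μ.map W ≪ unitsMeasure K d ∧ Integrable (llr (μ.map W) (unitsMeasure K d)) (μ.map W) ∧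
      ∫ x, llr (μ.map W) (unitsMeasure K d) x ∂(μ.map W)
        = d * ∫ ω, Real.log ‖V ω‖ ∂μ - diffEntropy V μ := by
  have he := measurableEmbedding_units_val (K := K)
  have hVm := hV.aemeasurable
  have : IsProbabilityMeasure (μ.map W) := Measure.isProbabilityMeasure_map hW
  have : IsProbabilityMeasure (μ.map V) := Measure.isProbabilityMeasure_map hVm
  have hmap : (μ.map W).map Units.val = μ.map V := by
    rw [AEMeasurable.map_map_of_aemeasurable measurable_units_val.aemeasurable hW]
    exact Measure.map_congr hWV
  have hac : μ.map W ≪ unitsMeasure K d := by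
    intro s hs
    have h1 : multiplicativeMeasure K d (Units.val '' s) = 0 := by
      rw [← map_unitsMeasure, he.map_apply, Set.preimage_image_eq _ he.injective, hs]
    have h2 := hV.absolutelyContinuous
      (volume_absolutelyContinuous_multiplicativeMeasure (d := d) h1)
    rwa [← hmap, he.map_apply, Set.preimage_image_eq _ he.injective] at h2
  have hae := llr_multiplicativeMeasure_ae_eq (d := d) hV.absolutelyContinuous
  have hlm : AEStronglyMeasurable (fun x : K => Real.log ‖x‖) (μ.map V) :=
    (by fun_prop : Measurable fun x : K => Real.log ‖x‖).aestronglyMeasurable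
  have i1 : Integrable (fun x : K => (d : ℝ) * Real.log ‖x‖) (μ.map V) :=
    ((integrable_map_measure hlm hVm).2 hlog).const_mul _
  -- Integrability of f log f for Lebesgue measure is integrability of log f for the law.
  have i2 : Integrable (fun x => Real.log ((μ.map V).rnDeriv volume x).toReal) (μ.map V) :=
    (integrable_rnDeriv_smul_iff hV.absolutelyContinuous).1 hV.integrable
  refine ⟨hac, ?_, ?_⟩
  · rw [← he.integrable_llr_map_iff hac, map_unitsMeasure, hmap, integrable_congr hae]
    exact i1.add i2
  · rw [← he.integral_llr_map hac, map_unitsMeasure, hmap, integral_congr_ae hae,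
      integral_add i1 i2, integral_const_mul, integral_map hVm hlm,
      ← integral_rnDeriv_smul hV.absolutelyContinuous, diffEntropy, sub_neg_eq_add]
    rfl

/-- Products and quotients of i.i.d. nonzero random variables in `ℝ` or `ℂ` have comparable
differential entropies. -/
theorem diffEntropy_mul_le_and_div_le
    (hscale : ∀ a : K, a ≠ 0 →
      (volume : Measure K).map (fun x => a * x) = (ENNReal.ofReal (‖a‖ ^ d))⁻¹ • volume)
    {X Y : Ω → K} (hind : IndepFun X Y μ) (hid : IdentDistrib X Y μ μ) (h0 : ∀ᵐ ω ∂μ, X ω ≠ 0)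
    (hX : HasFiniteEntropy X μ) (hm : HasFiniteEntropy (X * Y) μ)
    (hd : HasFiniteEntropy (X / Y) μ) (hlog : Integrable (fun ω => Real.log ‖X ω‖) μ) :
    diffEntropy (X * Y) μ ≤
        2 * diffEntropy (X / Y) μ - diffEntropy X μ + 3 * d * ∫ ω, Real.log ‖X ω‖ ∂μ ∧
      diffEntropy (X / Y) μ ≤
        2 * diffEntropy (X * Y) μ - diffEntropy X μ - 3 * d * ∫ ω, Real.log ‖X ω‖ ∂μ := by
  have := isMulLeftInvariant_unitsMeasure hscale
  have := isInvInvariant_unitsMeasure hscale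
  have hlm : Measurable fun x : K => Real.log ‖x‖ := by fun_prop
  have h0' : ∀ᵐ ω ∂μ, Y ω ≠ 0 :=
    hid.ae_mem_snd (t := {0}ᶜ) (measurableSet_singleton 0).compl h0
  have hidl := hid.comp hlm
  have hlog' : Integrable (fun ω => Real.log ‖Y ω‖) μ := hidl.integrable_iff.1 hlog
  have hLY : ∫ ω, Real.log ‖Y ω‖ ∂μ = ∫ ω, Real.log ‖X ω‖ ∂μ := hidl.integral_eq.symm
  have hlogm : (fun ω => Real.log ‖(X * Y) ω‖) =ᵐ[μ] fun ω => Real.log ‖X ω‖ + Real.log ‖Y ω‖ := by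
    filter_upwards [h0, h0'] with ω h h'
    rw [Pi.mul_apply, norm_mul, Real.log_mul (norm_ne_zero_iff.2 h) (norm_ne_zero_iff.2 h')]
  have hlogd : (fun ω => Real.log ‖(X / Y) ω‖) =ᵐ[μ] fun ω => Real.log ‖X ω‖ - Real.log ‖Y ω‖ := by
    filter_upwards [h0, h0'] with ω h h'
    rw [Pi.div_apply, norm_div, Real.log_div (norm_ne_zero_iff.2 h) (norm_ne_zero_iff.2 h')]
  have hXu := measurable_toUnit.comp_aemeasurable hid.aemeasurable_fst
  have hYu := measurable_toUnit.comp_aemeasurable hid.aemeasurable_snd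
  obtain ⟨a1, b1, c1⟩ := hX.llr_unitsMeasure (d := d) hXu
    (h0.mono fun ω h => val_toUnit h) hlog
  obtain ⟨a2, b2, c2⟩ := hm.llr_unitsMeasure (d := d) (hXu.mul hYu)
    (by filter_upwards [h0, h0'] with ω h h'; simp [val_toUnit h, val_toUnit h'])
    ((integrable_congr hlogm).2 (hlog.add hlog'))
  obtain ⟨a3, b3, c3⟩ := hd.llr_unitsMeasure (d := d) (hXu.div hYu)
    (by filter_upwards [h0, h0'] with ω h h'; simp [val_toUnit h, val_toUnit h'])
    ((integrable_congr hlogd).2 (hlog.sub hlog'))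
  have key := two_mul_integral_llr_mul_le_and_div_le
    (hind.comp measurable_toUnit measurable_toUnit) (hid.comp measurable_toUnit)
    a1 b1 a2 b2 a3 b3
  -- With L = E log|X|, the log-moments of product, quotient and X are 2L, 0 and L. The balance is
  -- 4d - d in one inequality and 2d + d in the other, hence 3d in both.
  rw [c1, c2, c3, integral_congr_ae hlogm, integral_congr_ae hlogd, integral_add hlog hlog',
    integral_sub hlog hlog', hLY] at key
  constructor
  · linarith [key.2]
  · linarith [key.1]

end Field

lemma Real.map_volume_mul_left_eq_norm (a : ℝ) (ha : a ≠ 0) :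
    (volume : Measure ℝ).map (fun x => a * x) = (ENNReal.ofReal (‖a‖ ^ 1))⁻¹ • volume := by
  rw [Real.map_volume_mul_left ha, pow_one, Real.norm_eq_abs, abs_inv,
    ENNReal.ofReal_inv_of_pos (abs_pos.2 ha)]

/-- As a real-linear map, multiplication by `a` has determinant equal to the field norm of `a` over
ℝ, which is |a|²; so d = 2. -/
lemma Complex.map_volume_mul_left_eq_norm (a : ℂ) (ha : a ≠ 0) :
    (volume : Measure ℂ).map (fun x => a * x) = (ENNReal.ofReal (‖a‖ ^ 2))⁻¹ • volume := by
  have hdet : LinearMap.det (Algebra.lmul ℝ ℂ a) = ‖a‖ ^ 2 := by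
    rw [← Algebra.norm_apply, Algebra.norm_complex_apply, Complex.normSq_eq_norm_sq]
  have hpos : 0 < ‖a‖ ^ 2 := by have := norm_pos_iff.2 ha; positivity
  have h := Measure.map_linearMap_addHaar_eq_smul_addHaar (volume : Measure ℂ)
    (f := Algebra.lmul ℝ ℂ a) (by rw [hdet]; exact hpos.ne')
  rw [hdet, abs_of_pos (inv_pos.2 hpos), ENNReal.ofReal_inv_of_pos hpos] at h
  exact h

end

theorem corollary5p1 {Ω : Type*} [MeasurableSpace Ω] (μ : Measure Ω) [IsProbabilityMeasure μ] :
    -- positive random variables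
    (∀ X Y : Ω → ℝ,
      IndepFun X Y μ → IdentDistrib X Y μ μ → (∀ᵐ ω ∂μ, 0 < X ω) →
      HasFiniteEntropy X μ → HasFiniteEntropy (X * Y) μ → HasFiniteEntropy (X / Y) μ →
      Integrable (fun ω => Real.log (X ω)) μ →
        diffEntropy (X * Y) μ ≤
          2 * diffEntropy (X / Y) μ - diffEntropy X μ + 3 * ∫ ω, Real.log (X ω) ∂μ ∧
        diffEntropy (X / Y) μ ≤
          2 * diffEntropy (X * Y) μ - diffEntropy X μ - 3 * ∫ ω, Real.log (X ω) ∂μ) ∧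
    -- circle-valued random variables (the group operation is written multiplicatively)
    (∀ Θ Θ' : Ω → Circle,
      IndepFun Θ Θ' μ → IdentDistrib Θ Θ' μ μ → relEntropyUniform Θ μ ≠ ⊤ →
        relEntropyUniform (Θ * Θ') μ ≠ ⊤ ∧ relEntropyUniform (Θ / Θ') μ ≠ ⊤ ∧
        1 / 2 * ((relEntropyUniform Θ μ).toReal - (relEntropyUniform (Θ / Θ') μ).toReal) ≤
          (relEntropyUniform Θ μ).toReal - (relEntropyUniform (Θ * Θ') μ).toReal ∧
        (relEntropyUniform Θ μ).toReal - (relEntropyUniform (Θ * Θ') μ).toReal ≤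
          2 * ((relEntropyUniform Θ μ).toReal - (relEntropyUniform (Θ / Θ') μ).toReal) ∧
        ((relEntropyUniform Θ μ).toReal - (relEntropyUniform (Θ / Θ') μ).toReal ≠ 0 →
          1 / 2 ≤ ((relEntropyUniform Θ μ).toReal - (relEntropyUniform (Θ * Θ') μ).toReal) /
            ((relEntropyUniform Θ μ).toReal - (relEntropyUniform (Θ / Θ') μ).toReal) ∧
          ((relEntropyUniform Θ μ).toReal - (relEntropyUniform (Θ * Θ') μ).toReal) /
            ((relEntropyUniform Θ μ).toReal - (relEntropyUniform (Θ / Θ') μ).toReal) ≤ 2)) ∧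
    -- nonzero complex random variables
    (∀ Z₁ Z₂ : Ω → ℂ,
      IndepFun Z₁ Z₂ μ → IdentDistrib Z₁ Z₂ μ μ → (∀ᵐ ω ∂μ, Z₁ ω ≠ 0) →
      HasFiniteEntropy Z₁ μ → HasFiniteEntropy (Z₁ * Z₂) μ → HasFiniteEntropy (Z₁ / Z₂) μ →
      Integrable (fun ω => Real.log ‖Z₁ ω‖) μ →
        diffEntropy (Z₁ * Z₂) μ ≤
          2 * diffEntropy (Z₁ / Z₂) μ - diffEntropy Z₁ μ + 6 * ∫ ω, Real.log ‖Z₁ ω‖ ∂μ ∧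
        diffEntropy (Z₁ / Z₂) μ ≤
          2 * diffEntropy (Z₁ * Z₂) μ - diffEntropy Z₁ μ - 6 * ∫ ω, Real.log ‖Z₁ ω‖ ∂μ) := by
  refine ⟨?_, ?_, ?_⟩
  · intro X Y hind hid hpos hX hm hd hlog
    have h := diffEntropy_mul_le_and_div_le (d := 1) Real.map_volume_mul_left_eq_norm hind hid
      (hpos.mono fun ω h => h.ne') hX hm hd (by simpa using hlog)
    simpa using h
  · intro Θ Θ' hind hid hfin
    obtain ⟨h1, h2, h3, h4⟩ := two_mul_relEntropyUniform_mul_le_and_div_le hind hid hfin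
    refine ⟨h1, h2, by linarith, by linarith, fun hne => ?_⟩
    -- The two bounds a/2 ≤ b ≤ 2a already force a ≥ 0, so a nonzero denominator is positive.
    have hpos : 0 < (relEntropyUniform Θ μ).toReal - (relEntropyUniform (Θ / Θ') μ).toReal :=
      lt_of_le_of_ne (by linarith) hne.symm
    rw [le_div_iff₀ hpos, div_le_iff₀ hpos]
    constructor <;> linarith
  · intro Z₁ Z₂ hind hid h0 hZ hm hd hlog
    have h := diffEntropy_mul_le_and_div_le (d := 2) Complex.map_volume_mul_left_eq_norm hind hid
      h0 hZ hm hd hlog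
    norm_num at h
    exact h
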